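/- Let $R>1$ be an integer, and let $B,L\subset\mathbb Z$ be two finite sets, each of which is a complete set of representatives for $\mathbb Z/R\mathbb Z$, with $0\in B$, $0\in L$ and $\gcd(B)=1$; let $N=\#B=\#L=R$. Let $\mu$ be the unique Borel probability measure on $\mathbb R$ with $\mu(E)=\frac1N\sum_{b\in B}\mu(\tau_b^{-1}(E))$ for all Borel sets $E$, where $\tau_b(x)=R^{-1}(x+b)$. Put $\sigma_l(x)=R^{-1}(x+l)$ for $l\in L$, and $m_B(x)=\frac1N\sum_{b\in B}e^{2\pi i bx}$. A set $\{x_0,\dots,x_{p-1}\}\subset\mathbb R$ with $p\ge1$ is called an extreme $L$-cycle if there are $l_0,\dots,l_{p-1}\in L$ with $\sigma_{l_i}(x_i)=x_{i+1}$ for $0\le i<p$, where $x_p:=x_0$, and $|m_B(x_i)|=1$ for all $i$. Define $\Lambda_0=\bigcup\{-C : C \text{ an extreme } L\text{-cycle}\}$, $\Lambda_{n+1}=R\Lambda_n+L$, and the Dirichlet kernel $D_n(x)=\sum_{\lambda\in\Lambda_n}e^{2\pi i\lambda x}$ (the sets $\Lambda_n$ are finite). Let $p_L(z)=\sum_{l\in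 L}z^l$, and let $\Delta(p_L)=\exp\left(\int_0^1\log|p_L(e^{2\pi i x})|\,dx\right)$ be its Mahler measure. If $\Delta(p_L)>1$, then for every $\rho$ with $1<\rho<\Delta(p_L)$ there exists a constant $C>0$ such that $$\int|D_n(x)|\,d\mu(x)\ge C\rho^n\quad\text{for all sufficiently large } n.$$ -/

import Mathlib

namespace MockFourier

open MeasureTheory ProbabilityTheory Filter Topology

noncomputable section

/-- A finite set of integers is a complete residue system modulo `R` (a complete set of
representatives of `ℤ / Rℤ`): each residue class contains exactly one of its elements. -/
def IsCompleteResidueSystem (R : ℕ) (S : Finset ℤ) : Prop :=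
  ∀ c : ZMod R, ∃! s : ℤ, s ∈ S ∧ (s : ZMod R) = c

/-- The affine contraction `x ↦ R⁻¹ (x + a)`: it is `τ_b` for `a = b ∈ B`, and `σ_l` for
`a = l ∈ L`. -/
def contraction (R : ℕ) (a : ℤ) (x : ℝ) : ℝ := (R : ℝ)⁻¹ * (x + a)

/-- The defining property of the invariant measure of the iterated function system `(τ_b)_{b ∈ B}`:
it is a Borel probability measure with `μ(E) = (1/N) ∑_{b ∈ B} μ(τ_b⁻¹ E)`, where `N = #B`. -/
def IsInvariantMeasure (R : ℕ) (B : Finset ℤ) (μ : Measure ℝ) : Prop :=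
  IsProbabilityMeasure μ ∧ ∀ E : Set ℝ, MeasurableSet E →
    μ E = (B.card : ENNReal)⁻¹ * ∑ b ∈ B, μ (contraction R b ⁻¹' E)

/-- The encoding map `(b₁, b₂, …) ↦ ∑_{k ≥ 1} R⁻ᵏ b_k` (the digits are indexed from `0` here). -/
def encoding (R : ℕ) (B : Finset ℤ) (ω : ℕ → B) : ℝ :=
  ∑' k : ℕ, ((ω k : ℤ) : ℝ) / (R : ℝ) ^ (k + 1)

/-- The invariant measure `μ_B`, constructed as the law of `∑_{k ≥ 1} R⁻ᵏ b_k` with independent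
digits `b_k`, uniformly distributed in `B`. By `isInvariantMeasure_iff` below it is the unique
measure with the property `IsInvariantMeasure`. -/
def invariantMeasure (R : ℕ) (B : Finset ℤ) : Measure ℝ :=
  (Measure.infinitePi fun _ : ℕ => uniformOn (Set.univ : Set B)).map (encoding R B)

lemma summable_digits {R : ℕ} (hR : 1 < R) (B : Finset ℤ) (ω : ℕ → B) :
    Summable fun k : ℕ => ((ω k : ℤ) : ℝ) / (R : ℝ) ^ (k + 1) := by
  have hR' : (1 : ℝ) < R := by exact_mod_cast hR
  obtain ⟨M, hM⟩ : ∃ M : ℝ, ∀ b ∈ B, |(b : ℝ)| ≤ M :=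
    ⟨∑ b ∈ B, |(b : ℝ)|, fun b hb =>
      Finset.single_le_sum (f := fun b : ℤ => |(b : ℝ)|) (fun _ _ => abs_nonneg _) hb⟩
  have hs : Summable fun k : ℕ => M * ((R : ℝ)⁻¹) ^ (k + 1) :=
    ((summable_nat_add_iff 1).2 (summable_geometric_of_lt_one (by positivity)
      (inv_lt_one_of_one_lt₀ hR'))).mul_left M
  refine Summable.of_norm_bounded hs fun k => ?_
  rw [norm_div, norm_pow, Real.norm_eq_abs, Real.norm_natCast, inv_pow, ← div_eq_mul_inv]
  gcongr
  exact hM _ (ω k).2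

lemma measurable_encoding {R : ℕ} (hR : 1 < R) (B : Finset ℤ) :
    Measurable (encoding R B) := by
  have h : ∀ n : ℕ, Measurable fun ω : ℕ → B =>
      ∑ k ∈ Finset.range n, ((ω k : ℤ) : ℝ) / (R : ℝ) ^ (k + 1) := by
    intro n
    refine Finset.measurable_sum _ fun k _ => ?_
    have : Measurable fun b : B => ((b : ℤ) : ℝ) / (R : ℝ) ^ (k + 1) := measurable_of_countable _
    exact this.comp (measurable_pi_apply k)
  refine measurable_of_tendsto_metrizable h ?_
  rw [tendsto_pi_nhds]
  exact fun ω => (summable_digits hR B ω).hasSum.tendsto_sum_nat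

/-- Put a digit in front of a sequence of digits. -/
def consDigit (B : Finset ℤ) (p : B × (ℕ → B)) (n : ℕ) : B := Nat.casesOn n p.1 p.2

lemma measurable_consDigit (B : Finset ℤ) : Measurable (consDigit B) := by
  rw [measurable_pi_iff]
  rintro (_ | n)
  · exact measurable_fst
  · exact (measurable_pi_apply n).comp measurable_snd

lemma encoding_consDigit {R : ℕ} (hR : 1 < R) (B : Finset ℤ) (b : B) (ω : ℕ → B) :
    encoding R B (consDigit B (b, ω)) = contraction R b (encoding R B ω) := by
  have h0 : (R : ℝ) ≠ 0 := by positivity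
  unfold encoding contraction
  rw [(summable_digits hR B _).tsum_eq_zero_add, mul_add, ← tsum_mul_left, add_comm]
  congr 1
  · refine tsum_congr fun k => ?_
    change ((ω k : ℤ) : ℝ) / _ = _
    field_simp
    ring
  · change ((b : ℤ) : ℝ) / _ = _
    field_simp
    ring

lemma map_consDigit {B : Finset ℤ} (P : Measure B) [IsProbabilityMeasure P] :
    (P.prod (Measure.infinitePi fun _ : ℕ => P)).map (consDigit B)
      = Measure.infinitePi fun _ : ℕ => P := by
  classical
  refine Measure.eq_infinitePi _ fun s t ht => ?_
  rw [Measure.map_apply (measurable_consDigit B)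
    (MeasurableSet.pi s.countable_toSet fun i _ => ht i)]
  have h1 : consDigit B ⁻¹' (Set.pi s t) =
      (if 0 ∈ s then t 0 else Set.univ) ×ˢ
        Set.pi ((s.erase 0).image Nat.pred : Finset ℕ) (fun n => t (n + 1)) := by
    ext ⟨b, ω⟩
    simp only [Set.mem_preimage, Set.mem_pi, Set.mem_prod, Finset.mem_coe, Finset.mem_image,
      Finset.mem_erase]
    constructor
    · intro h
      refine ⟨?_, ?_⟩
      · split_ifs with h0
        · exact h 0 h0
        · trivial
      · rintro n ⟨m, ⟨hm, hms⟩, rfl⟩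
        obtain ⟨k, rfl⟩ := Nat.exists_eq_succ_of_ne_zero hm
        exact h _ hms
    · rintro ⟨h0, h⟩ (_ | n) hn
      · rw [if_pos hn] at h0
        exact h0
      · exact h n ⟨n + 1, ⟨by simp, hn⟩, rfl⟩
  rw [h1, Measure.prod_prod, Measure.infinitePi_pi _ (fun i _ => ht _)]
  have h2 : ∏ i ∈ (s.erase 0).image Nat.pred, P (t (i + 1)) = ∏ i ∈ s.erase 0, P (t i) := by
    rw [Finset.prod_image]
    · refine Finset.prod_congr rfl fun i hi => ?_
      rw [Nat.pred_eq_sub_one, Nat.sub_add_cancel (Nat.pos_of_ne_zero (Finset.ne_of_mem_erase hi))]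
    · intro a ha b hb hab
      have ha' := Finset.ne_of_mem_erase ha
      have hb' := Finset.ne_of_mem_erase hb
      simp only [Nat.pred_eq_sub_one] at hab
      omega
  rw [h2]
  split_ifs with h0
  · rw [Finset.mul_prod_erase s (fun i => P (t i)) h0]
  · rw [measure_univ, one_mul, Finset.erase_eq_of_notMem h0]

lemma measurable_contraction (R : ℕ) (a : ℤ) : Measurable (contraction R a) := by
  unfold contraction
  fun_prop

/-- The measure constructed above is invariant. -/
theorem isInvariantMeasure_invariantMeasure {R : ℕ} (hR : 1 < R) {B : Finset ℤ}
    (hB : B.Nonempty) : IsInvariantMeasure R B (invariantMeasure R B) := by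
  have : Nonempty B := hB.to_subtype
  have hm := measurable_encoding hR B
  refine ⟨Measure.isProbabilityMeasure_map hm.aemeasurable, fun E hE => ?_⟩
  have hS : MeasurableSet (encoding R B ⁻¹' E) := hm hE
  have key : ∀ b : ℤ, invariantMeasure R B (contraction R b ⁻¹' E) =
      (Measure.infinitePi fun _ : ℕ => uniformOn (Set.univ : Set B))
        (encoding R B ⁻¹' (contraction R b ⁻¹' E)) := fun b =>
    Measure.map_apply hm (measurable_contraction R b hE)
  simp_rw [key]
  rw [invariantMeasure, Measure.map_apply hm hE]
  nth_rewrite 1 [← map_consDigit (uniformOn (Set.univ : Set B))]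
  rw [Measure.map_apply (measurable_consDigit B) hS,
    Measure.prod_apply (measurable_consDigit B hS), lintegral_fintype, Finset.mul_sum,
    ← Finset.sum_coe_sort B]
  refine Finset.sum_congr rfl fun b _ => ?_
  rw [mul_comm, uniformOn_univ, Measure.count_singleton, Fintype.card_coe, one_div]
  congr 2
  ext ω
  simp only [Set.mem_preimage, encoding_consDigit hR]

lemma IsInvariantMeasure.map_eq {R : ℕ} {B : Finset ℤ} {μ : Measure ℝ}
    (h : IsInvariantMeasure R B μ) :
    μ = (B.card : ENNReal)⁻¹ • ∑ b ∈ B, μ.map (contraction R b) := by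
  ext E hE
  rw [h.2 E hE, Measure.smul_apply, Measure.finsetSum_apply, smul_eq_mul]
  congr 1
  exact Finset.sum_congr rfl fun b _ => (Measure.map_apply (measurable_contraction R b) hE).symm

lemma IsInvariantMeasure.charFun_eq {R : ℕ} {B : Finset ℤ} {μ : Measure ℝ}
    (h : IsInvariantMeasure R B μ) (t : ℝ) :
    charFun μ t = (B.card : ℂ)⁻¹ * (∑ b ∈ B, Complex.exp (t / R * b * Complex.I)) *
      charFun μ (t / R) := by
  have := h.1
  conv_lhs => rw [h.map_eq]
  rw [charFun_apply_real, integral_smul_measure, integral_finsetSum_measure]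
  · rw [ENNReal.toReal_inv, ENNReal.toReal_natCast, mul_assoc, Finset.sum_mul, Complex.real_smul,
      Complex.ofReal_inv, Complex.ofReal_natCast]
    congr 1
    refine Finset.sum_congr rfl fun b _ => ?_
    rw [integral_map (measurable_contraction R b).aemeasurable (by fun_prop), charFun_apply_real,
      ← integral_const_mul]
    congr 1
    ext x
    rw [← Complex.exp_add]
    congr 1
    simp only [contraction]
    push_cast
    ring
  · intro b _
    have : IsProbabilityMeasure (μ.map (contraction R b)) :=
      Measure.isProbabilityMeasure_map (measurable_contraction R b).aemeasurable
    refine Integrable.of_bound (by fun_prop) 1 (Eventually.of_forall fun x => ?_)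
    rw [← Complex.ofReal_mul, Complex.norm_exp_ofReal_mul_I]

/-- There is only one invariant measure. -/
theorem IsInvariantMeasure.unique {R : ℕ} (hR : 1 < R) {B : Finset ℤ}
    {μ ν : Measure ℝ} (hμ : IsInvariantMeasure R B μ) (hν : IsInvariantMeasure R B ν) : μ = ν := by
  have := hμ.1
  have := hν.1
  have hR' : (1 : ℝ) < R := by exact_mod_cast hR
  refine Measure.ext_of_charFun (funext fun t => ?_)
  set d : ℝ → ℝ := fun s => ‖charFun μ s - charFun ν s‖ with hd
  have step : ∀ s, d s ≤ d (s / R) := by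
    intro s
    simp only [hd]
    rw [hμ.charFun_eq s, hν.charFun_eq s, ← mul_sub, norm_mul]
    refine mul_le_of_le_one_left (norm_nonneg _) ?_
    rw [norm_mul, norm_inv, Complex.norm_natCast]
    have : ‖∑ b ∈ B, Complex.exp (s / R * b * Complex.I)‖ ≤ B.card := by
      refine (norm_sum_le _ _).trans ?_
      rw [Finset.sum_congr rfl (g := fun _ => (1 : ℝ))]
      · simp
      · intro b _
        have : ((s : ℂ) / R * b * Complex.I) = ((s / R * b : ℝ) : ℂ) * Complex.I := by
          push_cast
          ring
        rw [this, Complex.norm_exp_ofReal_mul_I]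
    exact inv_mul_le_one_of_le₀ this (Nat.cast_nonneg _)
  have iter : ∀ n : ℕ, d t ≤ d (t * ((R : ℝ)⁻¹) ^ n) := by
    intro n
    induction n with
    | zero => simp
    | succ n ih =>
      refine ih.trans ((step _).trans (le_of_eq ?_))
      rw [pow_succ, ← mul_assoc, div_eq_mul_inv]
  have hlim : Tendsto (fun n : ℕ => d (t * ((R : ℝ)⁻¹) ^ n)) atTop (𝓝 0) := by
    have hc : Continuous d := by fun_prop
    have h0 : d 0 = 0 := by simp [hd]
    have h1 := (tendsto_pow_atTop_nhds_zero_of_lt_one (r := (R : ℝ)⁻¹) (by positivity)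
      (inv_lt_one_of_one_lt₀ hR')).const_mul t
    rw [mul_zero] at h1
    have h2 := (hc.tendsto 0).comp h1
    rwa [h0] at h2
  have : d t ≤ 0 := ge_of_tendsto' hlim iter
  exact sub_eq_zero.1 (norm_le_zero_iff.1 this)

/-- `invariantMeasure R B` is the unique invariant measure of the iterated function system. -/
theorem isInvariantMeasure_iff {R : ℕ} (hR : 1 < R) {B : Finset ℤ} (hB : B.Nonempty)
    (μ : Measure ℝ) : IsInvariantMeasure R B μ ↔ μ = invariantMeasure R B :=
  ⟨fun h => h.unique hR (isInvariantMeasure_invariantMeasure hR hB),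
    fun h => h ▸ isInvariantMeasure_invariantMeasure hR hB⟩

/-- The exponential function `e_t(x) = e^{2π i t x}`. -/
def expFun (t x : ℝ) : ℂ := Complex.exp (2 * Real.pi * Complex.I * t * x)

/-- `m_B(x) = (1/N) ∑_{b ∈ B} e^{2π i b x}`, where `N = #B`. -/
def maskFun (B : Finset ℤ) (x : ℝ) : ℂ := (B.card : ℂ)⁻¹ * ∑ b ∈ B, expFun b x

/-- `C` is an extreme `L`-cycle: `C = {x_0, …, x_{p-1}}` with `p ≥ 1`, there are digits
`l_0, …, l_{p-1} ∈ L` with `σ_{l_i} x_i = x_{i+1}` for `i < p`, where `x_p = x_0`, and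
`|m_B(x_i)| = 1` for all `i < p`. -/
def IsExtremeCycle (R : ℕ) (B L : Finset ℤ) (C : Set ℝ) : Prop :=
  ∃ (p : ℕ) (x : ℕ → ℝ) (l : ℕ → ℤ), 0 < p ∧ C = {y | ∃ i < p, y = x i} ∧
    (∀ i < p, l i ∈ L ∧ contraction R (l i) (x i) = x (i + 1)) ∧ x p = x 0 ∧
    ∀ i < p, ‖maskFun B (x i)‖ = 1

/-- The sets of frequencies: `Λ_0` is the union of the sets `-C` over all extreme `L`-cycles `C`,
and `Λ_{n+1} = R Λ_n + L`. -/
def frequencySet (R : ℕ) (B L : Finset ℤ) : ℕ → Set ℝ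
  | 0 => {y | ∃ C : Set ℝ, IsExtremeCycle R B L C ∧ -y ∈ C}
  | n + 1 => {y | ∃ x ∈ frequencySet R B L n, ∃ l ∈ L, y = R * x + l}

/-- The Dirichlet kernel `D_n(x) = ∑_{λ ∈ Λ_n} e^{2π i λ x}`, which is a finite sum
whenever `Λ_0` is finite, in particular for complete residue systems `B` and `L` modulo `R > 1`. -/
def dirichletKernel (R : ℕ) (B L : Finset ℤ) (n : ℕ) (x : ℝ) : ℂ :=
  ∑ᶠ t ∈ frequencySet R B L n, expFun t x

/-- The Laurent polynomial `p_L(z) = ∑_{l ∈ L} z^l`. -/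
def digitPolynomial (L : Finset ℤ) : LaurentPolynomial ℂ := ∑ l ∈ L, LaurentPolynomial.T l

/-- The value of a complex Laurent polynomial at a nonzero point. -/
def laurentEval (p : LaurentPolynomial ℂ) (z : ℂˣ) : ℂ := p.eval₂ (RingHom.id ℂ) z

/-- The point `e^{2π i x}` as a unit of `ℂ`. -/
def circlePoint (x : ℝ) : ℂˣ :=
  Units.mk0 (Complex.exp (2 * Real.pi * Complex.I * x)) (Complex.exp_ne_zero _)

open scoped Classical in
/-- The Mahler measure `Δ(p) = exp (∫_0^1 log |p(e^{2π i x})| dx)` of a Laurent polynomial, with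
the usual convention `Δ(0) = 0`. -/
def mahlerMeasure (p : LaurentPolynomial ℂ) : ℝ :=
  if p = 0 then 0
  else Real.exp (∫ x in (0 : ℝ)..1, Real.log ‖laurentEval p (circlePoint x)‖)

end

end MockFourier

namespace MockFourier

open MeasureTheory ProbabilityTheory Filter Topology

noncomputable section

/-! ### Exponentials and trigonometric polynomials -/

/-! Two facts carry the theorem. First, since `B` is a complete residue system, all nonzero integer
Fourier coefficients of the invariant measure vanish, so modulo 1 it is Lebesgue measure
(`IsInvariantMeasure.integral_norm_trigSum`). The condition `|m_B| = 1` together with `gcd(B) = 1`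
makes the cycle points integers, so `D_n` has period 1 and its `L¹(μ)` norm is its norm in
`L¹[0,1]`. Second, representations `R k + l` are unique, so `D_{n+1}(x) = D_n(R x) p_L(e^{2πix})`
(`trigSum_dilateAdd`). As `x ↦ R x` preserves Lebesgue measure modulo 1, the mean of `log |D_n|`
grows by exactly `log Δ(p_L)` at each step. Jensen's inequality (`exp_integral_log_norm_trigSum_le`)
then bounds the norm below by `Δ(D_0) Δ(p_L)^n`, where `Δ(D_0) > 0` is the Mahler measure of `D_0`.
-/

lemma norm_expFun (t x : ℝ) : ‖expFun t x‖ = 1 := by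
  have : (2 * Real.pi * Complex.I * t * x : ℂ) = ((2 * Real.pi * t * x : ℝ) : ℂ) * Complex.I := by
    push_cast
    ring
  rw [expFun, this, Complex.norm_exp_ofReal_mul_I]

lemma expFun_add (s t x : ℝ) : expFun (s + t) x = expFun s x * expFun t x := by
  rw [expFun, expFun, expFun, ← Complex.exp_add]
  congr 1
  push_cast
  ring

lemma expFun_mul_left (s t x : ℝ) : expFun (s * t) x = expFun t (s * x) := by
  rw [expFun, expFun]
  congr 1
  push_cast
  ring

lemma expFun_zero_right (t : ℝ) : expFun t 0 = 1 := by
  simp [expFun]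

lemma expFun_zero_left (x : ℝ) : expFun 0 x = 1 := by
  simp [expFun]

lemma expFun_eq_one_iff (t x : ℝ) : expFun t x = 1 ↔ ∃ k : ℤ, t * x = k := by
  rw [expFun, Complex.exp_eq_one_iff]
  refine exists_congr fun k => ⟨fun h => ?_, fun h => ?_⟩
  · have h2 : (2 * Real.pi * Complex.I : ℂ) * ((t * x : ℝ) : ℂ)
        = (2 * Real.pi * Complex.I) * ((k : ℝ) : ℂ) := by
      push_cast
      linear_combination h
    exact_mod_cast mul_left_cancel₀ Complex.two_pi_I_ne_zero h2
  · have h2 : (t : ℂ) * x = k := by exact_mod_cast h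
    linear_combination (2 * Real.pi * Complex.I : ℂ) * h2

lemma expFun_eq_fourier (k : ℤ) (x : ℝ) : expFun k x = fourier k (x : UnitAddCircle) := by
  rw [fourier_coe_apply, expFun]
  simp

lemma expFun_periodic (k : ℤ) : Function.Periodic (expFun k) 1 := fun x => by
  rw [expFun_eq_fourier, expFun_eq_fourier, AddCircle.coe_add_period]

/-- The trigonometric polynomial `∑_{k ∈ S} e^{2π i k x}`. -/
def trigSum (S : Finset ℤ) (x : ℝ) : ℂ := ∑ k ∈ S, expFun k x

lemma analyticAt_trigSum (S : Finset ℤ) (x : ℝ) : AnalyticAt ℝ (trigSum S) x := by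
  have h : ∀ k ∈ S, AnalyticAt ℝ (fun y : ℝ => expFun k y) x := fun k _ => by
    have hof : AnalyticAt ℝ (fun y : ℝ => (y : ℂ)) x := Complex.ofRealCLM.analyticAt x
    have hexp : AnalyticAt ℝ Complex.exp ((2 * Real.pi * Complex.I * (k : ℝ)) * x) :=
      analyticAt_cexp.restrictScalars
    exact hexp.comp_of_eq (analyticAt_const.mul hof) rfl
  exact Finset.analyticAt_fun_sum S h

lemma continuous_trigSum (S : Finset ℤ) : Continuous (trigSum S) :=
  continuous_iff_continuousAt.2 fun x => (analyticAt_trigSum S x).continuousAt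

lemma trigSum_periodic (S : Finset ℤ) : Function.Periodic (trigSum S) 1 := fun x =>
  Finset.sum_congr rfl fun k _ => expFun_periodic k x

lemma trigSum_zero_right (S : Finset ℤ) : trigSum S 0 = S.card := by
  simp [trigSum, expFun_zero_right]

lemma trigSum_zero_ne_zero {S : Finset ℤ} (hS : S.Nonempty) : trigSum S 0 ≠ 0 := by
  rw [trigSum_zero_right]
  exact_mod_cast hS.card_ne_zero

/-! ### Logarithmic means of trigonometric polynomials -/

lemma intervalIntegrable_log_norm_trigSum (S : Finset ℤ) (a b : ℝ) :
    IntervalIntegrable (fun x => Real.log ‖trigSum S x‖) volume a b :=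
  MeromorphicOn.intervalIntegrable_log_norm fun x _ => (analyticAt_trigSum S x).meromorphicAt

lemma intervalIntegrable_log_norm_trigSum_comp_mul (S : Finset ℤ) (c a b : ℝ) :
    IntervalIntegrable (fun x => Real.log ‖trigSum S (c * x)‖) volume a b := by
  refine MeromorphicOn.intervalIntegrable_log_norm (f := fun x => trigSum S (c * x))
    fun x _ => AnalyticAt.meromorphicAt ?_
  exact (analyticAt_trigSum S (c * x)).comp_of_eq (analyticAt_const.mul analyticAt_id) rfl

/-- By the identity theorem on the connected line the zeros are isolated, hence a null set. This
discards the points where `Real.log 0 = 0` would break the identities for logarithms. -/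
lemma ae_ne_zero_of_analyticAt {f : ℝ → ℂ} (hf : ∀ x, AnalyticAt ℝ f x) {x : ℝ} (hx : f x ≠ 0) :
    ∀ᵐ y : ℝ, f y ≠ 0 := by
  have h := AnalyticOnNhd.preimage_zero_mem_codiscrete (fun y _ => hf y) hx
  have h2 := ae_restrict_le_codiscreteWithin (μ := (volume : Measure ℝ)) MeasurableSet.univ h
  rw [Measure.restrict_univ] at h2
  exact h2

lemma ae_trigSum_ne_zero {S : Finset ℤ} (hS : S.Nonempty) : ∀ᵐ x : ℝ, trigSum S x ≠ 0 :=
  ae_ne_zero_of_analyticAt (analyticAt_trigSum S) (trigSum_zero_ne_zero hS)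

lemma ae_trigSum_comp_mul_ne_zero {S : Finset ℤ} (hS : S.Nonempty) (c : ℝ) :
    ∀ᵐ x : ℝ, trigSum S (c * x) ≠ 0 := by
  refine ae_ne_zero_of_analyticAt (f := fun x => trigSum S (c * x)) (x := 0) (fun x => ?_) ?_
  · exact (analyticAt_trigSum S (c * x)).comp_of_eq (analyticAt_const.mul analyticAt_id) rfl
  · rw [mul_zero]
    exact trigSum_zero_ne_zero hS

/-- The map `x ↦ R x` preserves the mean of `log |f|`. -/
lemma integral_log_norm_trigSum_comp_mul (S : Finset ℤ) {R : ℕ} (hR : R ≠ 0) :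
    ∫ x in (0 : ℝ)..1, Real.log ‖trigSum S (R * x)‖ = ∫ x in (0 : ℝ)..1, Real.log ‖trigSum S x‖ := by
  have hR' : (R : ℝ) ≠ 0 := by exact_mod_cast hR
  have hp : Function.Periodic (fun x => Real.log ‖trigSum S x‖) 1 := fun x => by
    simp only [trigSum_periodic S x]
  -- After the substitution the integral runs over `R` full periods, and the Jacobian `1/R` cancels
  -- the factor `R`.
  have h := hp.intervalIntegral_add_zsmul_eq R 0 (intervalIntegrable_log_norm_trigSum S)
  simp only [zero_add, natCast_zsmul, nsmul_eq_mul, mul_one] at h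
  rw [intervalIntegral.integral_comp_mul_left (fun x => Real.log ‖trigSum S x‖) hR', mul_zero,
    mul_one, h, smul_eq_mul, inv_mul_cancel_left₀ hR']

/-- Jensen's inequality for the logarithm of a trigonometric polynomial. -/
lemma exp_integral_log_norm_trigSum_le {S : Finset ℤ} (hS : S.Nonempty) :
    Real.exp (∫ x in (0 : ℝ)..1, Real.log ‖trigSum S x‖) ≤ ∫ x in (0 : ℝ)..1, ‖trigSum S x‖ := by
  set m := ∫ x in (0 : ℝ)..1, Real.log ‖trigSum S x‖ with hm
  have hi := intervalIntegrable_log_norm_trigSum S 0 1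
  have hc : IntervalIntegrable (fun x => ‖trigSum S x‖) volume 0 1 :=
    (continuous_trigSum S).norm.intervalIntegrable 0 1
  -- Integrated tangent-line inequality for `exp` at the mean `m`; the left side evaluates to `exp
  -- m`.
  have h : ∫ x in (0 : ℝ)..1, Real.exp m * (1 - m + Real.log ‖trigSum S x‖)
      ≤ ∫ x in (0 : ℝ)..1, ‖trigSum S x‖ := by
    refine intervalIntegral.integral_mono_ae zero_le_one
      ((intervalIntegrable_const.add hi).const_mul _) hc ?_
    filter_upwards [ae_trigSum_ne_zero hS] with x hx
    have h0 : 0 < ‖trigSum S x‖ := norm_pos_iff.2 hx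
    have h1 := Real.add_one_le_exp (Real.log ‖trigSum S x‖ - m)
    rw [Real.exp_sub, Real.exp_log h0, le_div_iff₀ (Real.exp_pos m)] at h1
    linarith
  rw [intervalIntegral.integral_const_mul, intervalIntegral.integral_add intervalIntegrable_const hi,
    ← hm] at h
  simpa using h

/-! ### The invariant measure modulo `1` -/

/-- Integration of continuous functions on the circle against (the image of) a finite measure on
the line. -/
def circleFunctional (μ : Measure ℝ) [IsFiniteMeasure μ] : C(UnitAddCircle, ℂ) →L[ℂ] ℂ :=
  have hint : ∀ f : C(UnitAddCircle, ℂ), Integrable (fun x : ℝ => f (x : UnitAddCircle)) μ :=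
    fun f => Integrable.of_bound
      (f.continuous.comp (AddCircle.continuous_mk' 1)).aestronglyMeasurable ‖f‖
      (Eventually.of_forall fun _ => f.norm_coe_le_norm _)
  LinearMap.mkContinuous
    { toFun := fun f => ∫ x : ℝ, f (x : UnitAddCircle) ∂μ
      map_add' := fun f g => integral_add (hint f) (hint g)
      map_smul' := fun c f => integral_const_mul c _ }
    (μ.real Set.univ) fun f => by
      rw [mul_comm]
      exact norm_integral_le_of_norm_le_const (Eventually.of_forall fun _ => f.norm_coe_le_norm _)

lemma circleFunctional_apply (μ : Measure ℝ) [IsFiniteMeasure μ] (f : C(UnitAddCircle, ℂ)) :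
    circleFunctional μ f = ∫ x : ℝ, f (x : UnitAddCircle) ∂μ := rfl

/-- Both functionals are continuous and the characters span a dense subspace of `C(UnitAddCircle,
ℂ)`. -/
lemma circleFunctional_eq {μ ν : Measure ℝ} [IsFiniteMeasure μ] [IsFiniteMeasure ν]
    (h : ∀ k : ℤ, ∫ x, expFun k x ∂μ = ∫ x, expFun k x ∂ν) :
    circleFunctional μ = circleFunctional ν := by
  refine ContinuousLinearMap.ext_on (s := Set.range (fourier (T := 1))) ?_ ?_
  · rw [Submodule.dense_iff_topologicalClosure_eq_top]
    exact span_fourier_closure_eq_top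
  · rintro _ ⟨k, rfl⟩
    simp only [circleFunctional_apply, ← expFun_eq_fourier]
    exact h k

/-- The integral of the modulus of a trigonometric polynomial depends only on the Fourier
coefficients of the measure. -/
lemma integral_norm_trigSum_eq {μ ν : Measure ℝ} [IsFiniteMeasure μ] [IsFiniteMeasure ν]
    (h : ∀ k : ℤ, ∫ x, expFun k x ∂μ = ∫ x, expFun k x ∂ν) (S : Finset ℤ) :
    ∫ x, ‖trigSum S x‖ ∂μ = ∫ x, ‖trigSum S x‖ ∂ν := by
  let f : C(UnitAddCircle, ℂ) :=
    ⟨fun y => ((‖∑ k ∈ S, fourier k y‖ : ℝ) : ℂ), by fun_prop⟩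
  have hf : ∀ x : ℝ, f (x : UnitAddCircle) = ((‖trigSum S x‖ : ℝ) : ℂ) := fun x => by
    simp only [f, ContinuousMap.coe_mk, trigSum, expFun_eq_fourier]
  have := congrArg (fun F => F f) (circleFunctional_eq h)
  simp only [circleFunctional_apply, hf] at this
  rw [integral_complex_ofReal, integral_complex_ofReal] at this
  exact_mod_cast this

lemma integral_expFun_eq_charFun (μ : Measure ℝ) (t : ℝ) :
    ∫ x, expFun t x ∂μ = charFun μ (2 * Real.pi * t) := by
  rw [charFun_apply_real]
  refine integral_congr_ae (Eventually.of_forall fun x => ?_)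
  simp only [expFun]
  congr 1
  push_cast
  ring

/-! ### Fourier coefficients of the invariant measure -/

lemma IsCompleteResidueSystem.eq_of_dvd_sub {R : ℕ} {S : Finset ℤ}
    (hS : IsCompleteResidueSystem R S) {a b : ℤ} (ha : a ∈ S) (hb : b ∈ S)
    (h : (R : ℤ) ∣ b - a) : a = b :=
  (hS (b : ZMod R)).unique ⟨ha, (ZMod.intCast_eq_intCast_iff_dvd_sub a b R).2 h⟩ ⟨hb, rfl⟩

/-- A nontrivial character of `ℤ / Rℤ` sums to zero over a complete residue system. -/
lemma IsCompleteResidueSystem.sum_expFun_eq_zero {R : ℕ} (hR : 1 < R) {B : Finset ℤ}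
    (hB : IsCompleteResidueSystem R B) {k : ℤ} (hk : ¬ (R : ℤ) ∣ k) :
    ∑ b ∈ B, expFun (k / R) b = 0 := by
  have : NeZero R := ⟨by omega⟩
  have hR0 : (R : ℝ) ≠ 0 := by positivity
  have hmod : ∀ a b : ℤ, (a : ZMod R) = b → expFun (k / R) a = expFun (k / R) b := by
    intro a b hab
    obtain ⟨c, hc⟩ := (ZMod.intCast_eq_intCast_iff_dvd_sub a b R).1 hab
    have hb : (b : ℝ) = a + R * c := by
      have : b = a + R * c := by linarith
      exact_mod_cast this
    rw [hb, show expFun (k / R) (a + R * c) = expFun (k / R) a * expFun (k / R) (R * c) by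
        rw [expFun, expFun, expFun, ← Complex.exp_add]; congr 1; push_cast; ring,
      (expFun_eq_one_iff (k / R) (R * c)).2 ⟨k * c, by push_cast; field_simp⟩, mul_one]
  have hsum : ∀ g : ZMod R → ℂ, ∑ b ∈ B, g (b : ZMod R) = ∑ c, g c := by
    intro g
    refine Finset.sum_bij (fun b _ => (b : ZMod R)) (fun _ _ => Finset.mem_univ _) ?_ ?_
      (fun _ _ => rfl)
    · intro a ha b hb hab
      exact (hB (b : ZMod R)).unique ⟨ha, hab⟩ ⟨hb, rfl⟩
    · intro c _
      obtain ⟨s, ⟨hs, hsc⟩, _⟩ := hB c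
      exact ⟨s, hs, hsc⟩
  set g : ZMod R → ℂ := fun c => expFun (k / R) (c.cast : ℤ) with hg
  have hgc : ∀ b : ℤ, g (b : ZMod R) = expFun (k / R) b := fun b =>
    hmod _ _ (by simp)
  have hshift : ∀ c : ZMod R, g (c + 1) = g c * expFun (k / R) 1 := by
    intro c
    have hc : ((c.cast + 1 : ℤ) : ZMod R) = c + 1 := by simp
    rw [← hc, hgc]
    simp only [hg, expFun]
    rw [← Complex.exp_add]
    congr 1
    push_cast
    ring
  -- The shift `c ↦ c + 1` permutes `ZMod R` and multiplies the sum by a root of unity different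
  -- from 1.
  have h1 : (∑ c, g c) * expFun (k / R) 1 = ∑ c, g c := by
    rw [Finset.sum_mul]
    simp_rw [← hshift]
    exact Fintype.sum_equiv (Equiv.addRight (1 : ZMod R)) _ _ fun _ => rfl
  have h2 : expFun (k / R) 1 ≠ 1 := by
    rw [Ne, expFun_eq_one_iff]
    rintro ⟨c, hc⟩
    refine hk ⟨c, ?_⟩
    rw [mul_one, div_eq_iff hR0] at hc
    have : k = c * R := by exact_mod_cast hc
    rw [this, mul_comm]
  rw [Finset.sum_congr rfl (fun b _ => (hgc b).symm), hsum]
  have h3 : (∑ c, g c) * (expFun (k / R) 1 - 1) = 0 := by rw [mul_sub, h1, mul_one, sub_self]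
  exact (mul_eq_zero.1 h3).resolve_right (sub_ne_zero.2 h2)

/-- The nonzero Fourier coefficients of the invariant measure vanish. -/
lemma IsInvariantMeasure.integral_expFun_eq_zero {R : ℕ} (hR : 1 < R) {B : Finset ℤ}
    (hB : IsCompleteResidueSystem R B) {μ : Measure ℝ} (hμ : IsInvariantMeasure R B μ) {k : ℤ}
    (hk : k ≠ 0) : ∫ x, expFun k x ∂μ = 0 := by
  have hR0 : (R : ℝ) ≠ 0 := by positivity
  have hstep : ∀ j : ℤ, ∫ x, expFun j x ∂μ =
      (B.card : ℂ)⁻¹ * (∑ b ∈ B, expFun (j / R) b) * ∫ x, expFun (j / R) x ∂μ := by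
    intro j
    rw [integral_expFun_eq_charFun, integral_expFun_eq_charFun, hμ.charFun_eq, mul_div_assoc]
    congr 2
    refine Finset.sum_congr rfl fun b _ => ?_
    simp only [expFun]
    congr 1
    push_cast
    ring
  -- Descent on `|j|`: if `R ∤ j`, the character sum in `hstep` vanishes; otherwise `j / R` is a
  -- nonzero integer of smaller modulus.
  have hind : ∀ n : ℕ, ∀ j : ℤ, j.natAbs ≤ n → j ≠ 0 → ∫ x, expFun j x ∂μ = 0 := by
    intro n
    induction n with
    | zero =>
      intro j hj hj0
      omega
    | succ n ih =>
      intro j hj hj0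
      rw [hstep]
      by_cases hd : (R : ℤ) ∣ j
      · obtain ⟨c, rfl⟩ := hd
        have hc0 : c ≠ 0 := by
          rintro rfl
          simp at hj0
        have hcn : c.natAbs ≤ n := by
          rw [Int.natAbs_mul, Int.natAbs_natCast] at hj
          have : 0 < c.natAbs := Int.natAbs_pos.2 hc0
          nlinarith
        have he : (((R : ℤ) * c : ℤ) : ℝ) / R = (c : ℤ) := by
          push_cast
          field_simp
        rw [he, ih c hcn hc0, mul_zero]
      · rw [hB.sum_expFun_eq_zero hR hd, mul_zero, zero_mul]
  exact hind _ k le_rfl hk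

lemma integral_expFun_Ioc {k : ℤ} (hk : k ≠ 0) :
    ∫ x, expFun k x ∂(volume.restrict (Set.Ioc (0 : ℝ) 1)) = 0 := by
  have hc : (2 * Real.pi * Complex.I * (k : ℝ) : ℂ) ≠ 0 :=
    mul_ne_zero Complex.two_pi_I_ne_zero (by exact_mod_cast hk)
  have h1 := expFun_periodic k 0
  rw [zero_add] at h1
  rw [← intervalIntegral.integral_of_le zero_le_one]
  simp only [expFun] at h1 ⊢
  rw [integral_exp_mul_complex hc, h1, sub_self, zero_div]

/-- Modulo `1` the invariant measure is Lebesgue measure. -/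
lemma IsInvariantMeasure.integral_norm_trigSum {R : ℕ} (hR : 1 < R) {B : Finset ℤ}
    (hB : IsCompleteResidueSystem R B) {μ : Measure ℝ} (hμ : IsInvariantMeasure R B μ)
    (S : Finset ℤ) : ∫ x, ‖trigSum S x‖ ∂μ = ∫ x in (0 : ℝ)..1, ‖trigSum S x‖ := by
  have := hμ.1
  rw [intervalIntegral.integral_of_le zero_le_one]
  refine integral_norm_trigSum_eq (fun k => ?_) S
  rcases eq_or_ne k 0 with rfl | hk
  · simp [expFun_zero_left]
  · rw [hμ.integral_expFun_eq_zero hR hB hk, integral_expFun_Ioc hk]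

/-! ### The frequency sets -/

/-- Equality in the triangle inequality aligns all the unit vectors, and the one for `0 ∈ B` is 1.
-/
lemma expFun_eq_one_of_norm_maskFun {B : Finset ℤ} (h0 : (0 : ℤ) ∈ B) {x : ℝ}
    (h : ‖maskFun B x‖ = 1) {b : ℤ} (hb : b ∈ B) : expFun b x = 1 := by
  rcases eq_or_ne b 0 with rfl | hb0
  · rw [Int.cast_zero, expFun_zero_left]
  have hcard : (0 : ℝ) < B.card := by exact_mod_cast Finset.card_pos.2 ⟨0, h0⟩
  rw [maskFun, norm_mul, norm_inv, Complex.norm_natCast, inv_mul_eq_one₀ hcard.ne'] at h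
  have hb' : b ∈ B.erase 0 := Finset.mem_erase.2 ⟨hb0, hb⟩
  rw [← Finset.add_sum_erase B _ h0, ← Finset.add_sum_erase (B.erase 0) _ hb', Int.cast_zero,
    expFun_zero_left, ← add_assoc] at h
  have hrest : ‖∑ a ∈ (B.erase 0).erase b, expFun a x‖ ≤ (B.card : ℝ) - 2 := by
    refine (norm_sum_le _ _).trans (le_of_eq ?_)
    simp_rw [norm_expFun]
    rw [Finset.sum_const, nsmul_eq_mul, mul_one]
    have h1 := Finset.card_erase_add_one h0
    have h2 := Finset.card_erase_add_one hb'
    have h3 : (B.card : ℝ) = ((B.erase 0).erase b).card + 1 + 1 := by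
      rw [← h1, ← h2]
      push_cast
      ring
    linarith
  -- The other `#B - 2` terms contribute at most `#B - 2`, so these two must supply the remaining 2.
  have h2 : 2 ≤ ‖1 + expFun b x‖ := by
    have := norm_add_le (1 + expFun b x) (∑ a ∈ (B.erase 0).erase b, expFun a x)
    linarith
  have hn := norm_expFun b x
  set z := expFun b x
  have e1 : ‖1 + z‖ ^ 2 = (1 + z.re) ^ 2 + z.im ^ 2 := by
    rw [Complex.sq_norm, Complex.normSq_apply]
    simp
    ring
  have e2 : z.re ^ 2 + z.im ^ 2 = 1 := by
    have := Complex.sq_norm z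
    rw [hn, Complex.normSq_apply] at this
    linarith
  have e3 : 1 ≤ z.re := by nlinarith
  have e4 : z.im = 0 := by nlinarith [sq_nonneg z.im]
  have e5 : z.re = 1 := by nlinarith [sq_nonneg z.im]
  exact Complex.ext (by simpa using e5) (by simpa using e4)

/-- Every `b x` with `b ∈ B` is an integer, and a Bézout combination of them is `x`. -/
lemma exists_intCast_eq_of_norm_maskFun {B : Finset ℤ} (h0 : (0 : ℤ) ∈ B) (hgcd : B.gcd id = 1)
    {x : ℝ} (h : ‖maskFun B x‖ = 1) : ∃ k : ℤ, x = k := by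
  have hk : ∀ b : ℤ, ∃ k : ℤ, b ∈ B → (b : ℝ) * x = k := fun b => by
    by_cases hb : b ∈ B
    · obtain ⟨k, hk⟩ := (expFun_eq_one_iff b x).1 (expFun_eq_one_of_norm_maskFun h0 h hb)
      exact ⟨k, fun _ => hk⟩
    · exact ⟨0, fun hb' => absurd hb' hb⟩
  choose k hk using hk
  obtain ⟨g, hg⟩ := Finset.gcd_eq_sum_mul B id
  rw [hgcd] at hg
  refine ⟨∑ b ∈ B, g b * k b, ?_⟩
  have hg' : (1 : ℝ) = ∑ b ∈ B, (b : ℝ) * g b := by exact_mod_cast hg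
  push_cast
  rw [← one_mul x, hg', Finset.sum_mul]
  refine Finset.sum_congr rfl fun b hb => ?_
  rw [← hk b hb]
  ring

/-- A cycle point `x i` of maximal modulus has a predecessor of no larger modulus, so `R |x i| ≤ |x
i| + M`, and `R ≥ 2`. -/
lemma abs_le_of_mem_extremeCycle {R : ℕ} (hR : 1 < R) {B L : Finset ℤ} {M : ℝ}
    (hM : ∀ l ∈ L, |(l : ℝ)| ≤ M) {C : Set ℝ} (hC : IsExtremeCycle R B L C) {y : ℝ} (hy : y ∈ C) :
    |y| ≤ M := by
  obtain ⟨p, x, l, hp, rfl, hx, hxp, -⟩ := hC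
  obtain ⟨j, hj, rfl⟩ := hy
  obtain ⟨i, hi, hmax⟩ := Finset.exists_max_image (Finset.range p) (fun i => |x i|)
    ⟨0, Finset.mem_range.2 hp⟩
  simp only [Finset.mem_range] at hi hmax
  refine (hmax j hj).trans ?_
  obtain ⟨i', hi', hii'⟩ : ∃ i' < p, x (i' + 1) = x i := by
    rcases i with _ | i
    · exact ⟨p - 1, by omega, by rw [Nat.sub_add_cancel hp, hxp]⟩
    · exact ⟨i, by omega, rfl⟩
  obtain ⟨hl, he⟩ := hx i' hi'
  have hR2 : (2 : ℝ) ≤ R := by exact_mod_cast hR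
  have h1 : x i' + l i' = R * x i := by
    rw [← hii', ← he, contraction, mul_inv_cancel_left₀ (by positivity)]
  have h2 : R * |x i| ≤ |x i| + M := by
    calc (R : ℝ) * |x i| = |x i' + l i'| := by rw [h1, abs_mul, Nat.abs_cast]
      _ ≤ |x i'| + |(l i' : ℝ)| := abs_add_le _ _
      _ ≤ |x i| + M := add_le_add (hmax i' hi') (hM _ hl)
  nlinarith [abs_nonneg (x i)]

/-- The extreme cycles consist of finitely many integers. -/
lemma exists_frequencySet_zero_eq {R : ℕ} (hR : 1 < R) {B L : Finset ℤ} (h0B : (0 : ℤ) ∈ B)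
    (h0L : (0 : ℤ) ∈ L) (hgcd : B.gcd id = 1) :
    ∃ S : Finset ℤ, S.Nonempty ∧ frequencySet R B L 0 = (fun k : ℤ => (k : ℝ)) '' S := by
  set M : ℝ := ∑ l ∈ L, |(l : ℝ)|
  have hM : ∀ l ∈ L, |(l : ℝ)| ≤ M := fun l hl =>
    Finset.single_le_sum (f := fun l : ℤ => |(l : ℝ)|) (fun _ _ => abs_nonneg _) hl
  have hfin : {k : ℤ | (k : ℝ) ∈ frequencySet R B L 0}.Finite := by
    refine (Set.finite_Icc (-⌈M⌉) ⌈M⌉).subset ?_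
    rintro k ⟨C, hC, hk⟩
    have h := (abs_le_of_mem_extremeCycle hR hM hC hk).trans (Int.le_ceil M)
    rw [abs_neg] at h
    exact abs_le.1 (by exact_mod_cast h)
  -- The fixed point 0 of `σ_0` is an extreme cycle. Nonemptiness matters because a trigonometric
  -- sum over a nonempty set is nonzero at 0.
  have hzero : (0 : ℝ) ∈ frequencySet R B L 0 := by
    have hcard : (B.card : ℂ) ≠ 0 := by exact_mod_cast Finset.card_ne_zero_of_mem h0B
    refine ⟨{y | ∃ i < 1, y = 0}, ⟨1, fun _ => 0, fun _ => 0, one_pos, rfl, fun i _ => ⟨h0L, ?_⟩,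
      rfl, fun i _ => ?_⟩, 0, one_pos, neg_zero⟩
    · simp [contraction]
    · simp [maskFun, expFun_zero_right, hcard]
  refine ⟨hfin.toFinset, ⟨0, by simpa using hzero⟩, ?_⟩
  ext y
  simp only [Set.mem_image, Set.Finite.coe_toFinset, Set.mem_ofPred_eq]
  refine ⟨fun hy => ?_, ?_⟩
  · have hy' := hy
    obtain ⟨C, ⟨p, x, l, -, rfl, -, -, hm⟩, i, hi, hyi⟩ := hy
    obtain ⟨k, hk⟩ := exists_intCast_eq_of_norm_maskFun h0B hgcd (hm i hi)
    have hyk : ((-k : ℤ) : ℝ) = y := by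
      push_cast
      rw [← hk, ← hyi, neg_neg]
    exact ⟨-k, hyk ▸ hy', hyk⟩
  · rintro ⟨k, hk, rfl⟩
    exact hk

/-! ### Product structure of the Dirichlet kernels -/

/-- The finite set `R S + L`. -/
def dilateAdd (R : ℕ) (L S : Finset ℤ) : Finset ℤ :=
  (S ×ˢ L).image fun q => R * q.1 + q.2

lemma frequencySet_succ_eq {R : ℕ} {B L S : Finset ℤ} {n : ℕ}
    (h : frequencySet R B L n = (fun k : ℤ => (k : ℝ)) '' S) :
    frequencySet R B L (n + 1) = (fun k : ℤ => (k : ℝ)) '' (dilateAdd R L S) := by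
  ext y
  simp only [frequencySet, h, dilateAdd, Set.mem_image, Finset.mem_coe, Set.mem_ofPred_eq,
    Finset.mem_image, Finset.mem_product, Prod.exists]
  constructor
  · rintro ⟨_, ⟨k, hk, rfl⟩, l, hl, rfl⟩
    exact ⟨R * k + l, ⟨k, l, ⟨hk, hl⟩, rfl⟩, by push_cast; rfl⟩
  · rintro ⟨_, ⟨k, l, ⟨hk, hl⟩, rfl⟩, rfl⟩
    exact ⟨k, ⟨k, hk, rfl⟩, l, hl, by push_cast; rfl⟩

lemma nonempty_dilateAdd {R : ℕ} {L S : Finset ℤ} (hL : L.Nonempty) (hS : S.Nonempty) :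
    (dilateAdd R L S).Nonempty :=
  (hS.product hL).image _

/-- Elements of `L` are distinct modulo `R`, so `R k + l` determines `l` and then `k`: no frequency
in the expanded product repeats. -/
lemma trigSum_dilateAdd {R : ℕ} (hR : R ≠ 0) {L : Finset ℤ} (hL : IsCompleteResidueSystem R L)
    (S : Finset ℤ) (x : ℝ) :
    trigSum (dilateAdd R L S) x = trigSum S (R * x) * trigSum L x := by
  rw [trigSum, dilateAdd, Finset.sum_image, Finset.sum_product, trigSum, trigSum,
    Finset.sum_mul_sum]
  · refine Finset.sum_congr rfl fun k _ => Finset.sum_congr rfl fun l _ => ?_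
    push_cast
    rw [expFun_add, expFun_mul_left]
  · rintro ⟨k, l⟩ hq ⟨k', l'⟩ hq' heq
    simp only [Finset.coe_product, Set.mem_prod, Finset.mem_coe] at hq hq' heq
    have hll : l = l' := hL.eq_of_dvd_sub hq.2 hq'.2 ⟨k - k', by linarith⟩
    subst hll
    have hR' : (R : ℤ) ≠ 0 := by exact_mod_cast hR
    have : k = k' := mul_left_cancel₀ hR' (by linarith)
    rw [this]

lemma integral_log_norm_trigSum_dilateAdd {R : ℕ} (hR : R ≠ 0) {L : Finset ℤ}
    (hL : IsCompleteResidueSystem R L) (hL0 : L.Nonempty) {S : Finset ℤ} (hS : S.Nonempty) :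
    ∫ x in (0 : ℝ)..1, Real.log ‖trigSum (dilateAdd R L S) x‖ =
      (∫ x in (0 : ℝ)..1, Real.log ‖trigSum S x‖) + ∫ x in (0 : ℝ)..1, Real.log ‖trigSum L x‖ := by
  rw [← integral_log_norm_trigSum_comp_mul S hR, ← intervalIntegral.integral_add
    (intervalIntegrable_log_norm_trigSum_comp_mul S R 0 1)
    (intervalIntegrable_log_norm_trigSum L 0 1)]
  refine intervalIntegral.integral_congr_ae ?_
  filter_upwards [ae_trigSum_comp_mul_ne_zero hS R, ae_trigSum_ne_zero hL0] with x h1 h2 _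
  rw [trigSum_dilateAdd hR hL, norm_mul, Real.log_mul (norm_ne_zero_iff.2 h1)
    (norm_ne_zero_iff.2 h2)]

lemma dirichletKernel_eq_trigSum {R : ℕ} {B L S : Finset ℤ} {n : ℕ}
    (h : frequencySet R B L n = (fun k : ℤ => (k : ℝ)) '' S) :
    dirichletKernel R B L n = trigSum S := by
  ext x
  rw [dirichletKernel, h, finsum_mem_image (Int.cast_injective.injOn), finsum_mem_coe_finset,
    trigSum]

lemma laurentEval_digitPolynomial (L : Finset ℤ) (x : ℝ) :
    laurentEval (digitPolynomial L) (circlePoint x) = trigSum L x := by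
  rw [laurentEval, digitPolynomial, map_sum, trigSum]
  refine Finset.sum_congr rfl fun l _ => ?_
  rw [LaurentPolynomial.eval₂_T, Units.val_zpow_eq_zpow_val, circlePoint, Units.val_mk0, expFun,
    ← Complex.exp_int_mul]
  congr 1
  push_cast
  ring

end

end MockFourier

/-! ### Exponential growth of the norms -/

open MockFourier in
theorem theorem4p4 (R : ℕ) (hR : 1 < R) (B L : Finset ℤ) (h0B : (0 : ℤ) ∈ B) (h0L : (0 : ℤ) ∈ L)
    (hB : MockFourier.IsCompleteResidueSystem R B) (hL : MockFourier.IsCompleteResidueSystem R L)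
    (hgcd : B.gcd id = 1)
    (hΔ : 1 < MockFourier.mahlerMeasure (MockFourier.digitPolynomial L))
    (ρ : ℝ) (hρ : 1 < ρ) (hρΔ : ρ < MockFourier.mahlerMeasure (MockFourier.digitPolynomial L)) :
    ∃ C : ℝ, 0 < C ∧ ∀ᶠ n : ℕ in Filter.atTop,
      C * ρ ^ n ≤
        ∫ x, ‖MockFourier.dirichletKernel R B L n x‖ ∂(MockFourier.invariantMeasure R B) := by
  have hμ := isInvariantMeasure_invariantMeasure hR ⟨0, h0B⟩
  set m := ∫ x in (0 : ℝ)..1, Real.log ‖trigSum L x‖ with hm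
  have hΔm : mahlerMeasure (digitPolynomial L) = Real.exp m := by
    -- Under the convention `Δ(0) = 0`, `hΔ` excludes the zero polynomial.
    have hne : digitPolynomial L ≠ 0 := by
      intro h
      rw [mahlerMeasure, if_pos h] at hΔ
      linarith
    rw [mahlerMeasure, if_neg hne]
    simp only [laurentEval_digitPolynomial, hm]
  obtain ⟨S, hS, hfreq⟩ := exists_frequencySet_zero_eq hR h0B h0L hgcd
  set m₀ := ∫ x in (0 : ℝ)..1, Real.log ‖trigSum S x‖ with hm₀
  have hΛ : ∀ n : ℕ, ∃ T : Finset ℤ, T.Nonempty ∧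
      frequencySet R B L n = (fun k : ℤ => (k : ℝ)) '' T ∧
      ∫ x in (0 : ℝ)..1, Real.log ‖trigSum T x‖ = m₀ + n * m := by
    intro n
    induction n with
    | zero => exact ⟨S, hS, hfreq, by simp [hm₀]⟩
    | succ n ih =>
      obtain ⟨T, hT, hTf, hTm⟩ := ih
      refine ⟨dilateAdd R L T, nonempty_dilateAdd ⟨0, h0L⟩ hT, frequencySet_succ_eq hTf, ?_⟩
      rw [integral_log_norm_trigSum_dilateAdd (by omega) hL ⟨0, h0L⟩ hT, hTm, ← hm]
      push_cast
      ring
  -- The constant is the Mahler measure of `D_0`; with it the bound holds for every `n`.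
  refine ⟨Real.exp m₀, Real.exp_pos _, Filter.Eventually.of_forall fun n => ?_⟩
  obtain ⟨T, hT, hTf, hTm⟩ := hΛ n
  rw [dirichletKernel_eq_trigSum hTf, hμ.integral_norm_trigSum hR hB]
  refine le_trans ?_ (exp_integral_log_norm_trigSum_le hT)
  rw [hTm, Real.exp_add, Real.exp_nat_mul, ← hΔm]
  gcongr
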